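/- All graphs are finite, nonempty, undirected, without loops and multiple edges, and are considered up to isomorphism. A class of graphs is hereditary if with every graph it contains all its (nonempty) induced subgraphs. A graph $G$ is a unit interval graph if one can assign to each vertex $v$ a real number $l(v)$ so that distinct vertices $u,v$ are adjacent if and only if the intervals $[l(u),l(u)+1]$ and $[l(v),l(v)+1]$ intersect. The clique-width of a graph $G$ is the minimum number of labels needed to construct $G$ (up to isomorphism, and disregarding the final labels) by means of the four operations: creation of a new vertex with label $i$; disjoint union of two labelled graphs; joining by an edge each vertex with label $i$ to each vertex with label $j$, where $i\neq j$; renaming label $i$ to $j$. **Theorem.** Let $X$ be a proper hereditary subclass of the class of unit interval graphs. Then the clique-width of graphs in $X$ is bounded by a constant, i.e. there is a natural number $c$ (depending on $X$) such that every graph in $X$ has clique-width at most $c$. Consequently, the class of unit interval graphs is a minimal hereditary class of unbounded clique-width: it is hereditary, for every natural number $c$ it contains a graph of clique-width greater than $c$, and no proper hereditary subclass of it has unbounded clique-width. -/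

import Mathlib

universe u

/-- A finite, nonempty, simple undirected graph. -/
structure FinGraph : Type (u + 1) where
  /-- the vertex set -/
  V : Type u
  [finite : Finite V]
  [nonempty : Nonempty V]
  /-- the graph -/
  graph : SimpleGraph V

/-- A class of graphs is hereditary if with every graph it contains all its (nonempty) induced
subgraphs. As usual, graphs are considered up to isomorphism, so that the classes are also closed
under isomorphism: `H ↪g G` says that `H` is isomorphic to an induced subgraph of `G`. -/
def IsHereditary (X : Set FinGraph.{u}) : Prop :=
  ∀ G ∈ X, ∀ H : FinGraph.{u}, Nonempty (H.graph ↪g G.graph) → H ∈ X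

/-- `G` is a unit interval graph: the intersection graph of closed intervals
`[l v, l v + 1]` on the real line. -/
def IsUnitInterval {V : Type u} (G : SimpleGraph V) : Prop :=
  ∃ l : V → ℝ, ∀ u v : V, G.Adj u v ↔
    u ≠ v ∧ (Set.Icc (l u) (l u + 1) ∩ Set.Icc (l v) (l v + 1)).Nonempty

/-- The class of all unit interval graphs. -/
def unitIntervalGraphs : Set FinGraph.{u} :=
  {G | IsUnitInterval G.graph}

/-- `CWBuild k G lab` says that the graph `G`, whose vertices are labelled by `lab`, can be
constructed with the `k` labels in `Fin k` by means of the four clique-width operations. Labelled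
graphs are considered up to isomorphism, which is what the last clause says. -/
inductive CWBuild (k : ℕ) : {V : Type u} → SimpleGraph V → (V → Fin k) → Prop where
  /-- creation of a new vertex with label `i` -/
  | vertex (i : Fin k) : CWBuild k (⊥ : SimpleGraph PUnit.{u + 1}) (fun _ => i)
  /-- disjoint union of two labelled graphs -/
  | union {V W : Type u} {G : SimpleGraph V} {H : SimpleGraph W} {a : V → Fin k} {b : W → Fin k} :
      CWBuild k G a → CWBuild k H b → CWBuild k (G ⊕g H) (Sum.elim a b)
  /-- joining by an edge each vertex with label `i` to each vertex with label `j`, for `i ≠ j` -/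
  | join {V : Type u} {G : SimpleGraph V} {a : V → Fin k} (i j : Fin k) :
      i ≠ j → CWBuild k G a →
        CWBuild k (G ⊔ SimpleGraph.fromRel (fun u v => a u = i ∧ a v = j)) a
  /-- renaming label `i` to `j` -/
  | rename {V : Type u} {G : SimpleGraph V} {a : V → Fin k} (i j : Fin k) :
      CWBuild k G a → CWBuild k G (fun v => if a v = i then j else a v)
  /-- replacing a labelled graph by an isomorphic one -/
  | iso {V W : Type u} {G : SimpleGraph V} {H : SimpleGraph W} {a : V → Fin k} (φ : H ≃g G) :
      CWBuild k G a → CWBuild k H (fun w => a (φ w))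

/-- The clique-width of a graph: the minimum number of labels needed to construct it by the four
operations. (The value is `⊤` if there is no construction, which happens for no finite nonempty
graph.) -/
noncomputable def cliqueWidth {V : Type u} (G : SimpleGraph V) : ℕ∞ :=
  ⨅ (k : ℕ) (_ : ∃ lab : V → Fin k, CWBuild k G lab), (k : ℕ∞)

/-- Clique-width is bounded by a constant in the class `X`. -/
def HasBoundedCliqueWidth (X : Set FinGraph.{u}) : Prop :=
  ∃ c : ℕ, ∀ G ∈ X, cliqueWidth G.graph ≤ (c : ℕ∞)

/-! Unboundedness. A construction with few labels yields a vertex set of prescribed size, up to a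
factor of two, whose vertices have few distinct neighbourhoods outside it
(`CWBuild.exists_balanced_cut`). A suitable power of a path is a unit interval graph without such a
set (`not_exists_balanced_cut`).

Boundedness of proper subclasses. Splitting each left endpoint into integer and fractional part
places a unit interval graph on a grid, where columns are cliques and adjacency between neighbouring
columns compares rows. Hence every unit interval graph embeds in some `gridGraph n m`, and a proper
hereditary subclass omits one of these grids. In a graph without that grid, each strip of `n`
consecutive columns is crossed by a monotone staircase with fewer than `n * m` steps that misses
every vertex (`IsGridModel.exists_staircase`). Adjacency across a staircase depends only on column
and step. Adding vertices cell by cell between consecutive staircases, and by rows inside a cell,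
therefore meets boundedly many neighbourhood types at any time, and this bounds the clique-width
(`cliqueWidth_le_of_ordering`). -/

/-! ### Balanced cuts from clique-width constructions -/

/-- At a disjoint union, either one side has more than `t` vertices and supplies the cut, or both
have at most `t` and the whole vertex set serves. Equality of current labels is carried along
because a later join treats equally labelled vertices alike. -/
theorem CWBuild.exists_balanced_cut {k : ℕ} {V : Type u} {G : SimpleGraph V} {lab : V → Fin k}
    (h : CWBuild k G lab) (t : ℕ) (ht : 1 ≤ t) :
    Finite V ∧ (t < Nat.card V → ∃ (A : Set V) (f : V → Fin k), t < A.ncard ∧ A.ncard ≤ 2 * t ∧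
      ∀ u ∈ A, ∀ v ∈ A, f u = f v → lab u = lab v ∧ ∀ w ∉ A, (G.Adj u w ↔ G.Adj v w)) := by
  induction h with
  | vertex i => exact ⟨inferInstance, fun h => by simp at h; omega⟩
  | @union V W G H a b _ _ ihG ihH =>
    obtain ⟨hV, ihG⟩ := ihG
    obtain ⟨hW, ihH⟩ := ihH
    refine ⟨inferInstance, fun hc => ?_⟩
    rw [Nat.card_sum] at hc
    by_cases h1 : t < Nat.card V
    · obtain ⟨A, f, hA1, hA2, hf⟩ := ihG h1
      refine ⟨Sum.inl '' A, Sum.elim f b, ?_, ?_, ?_⟩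
      · rwa [Set.ncard_image_of_injective _ Sum.inl_injective]
      · rwa [Set.ncard_image_of_injective _ Sum.inl_injective]
      · rintro _ ⟨u, hu, rfl⟩ _ ⟨v, hv, rfl⟩ huv
        obtain ⟨hl, hN⟩ := hf u hu v hv huv
        refine ⟨hl, ?_⟩
        rintro (w | w) hw
        · simpa using hN w (fun h => hw ⟨w, h, rfl⟩)
        · simp
    by_cases h2 : t < Nat.card W
    · obtain ⟨A, f, hA1, hA2, hf⟩ := ihH h2
      refine ⟨Sum.inr '' A, Sum.elim a f, ?_, ?_, ?_⟩
      · rwa [Set.ncard_image_of_injective _ Sum.inr_injective]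
      · rwa [Set.ncard_image_of_injective _ Sum.inr_injective]
      · rintro _ ⟨u, hu, rfl⟩ _ ⟨v, hv, rfl⟩ huv
        obtain ⟨hl, hN⟩ := hf u hu v hv huv
        refine ⟨hl, ?_⟩
        rintro (w | w) hw
        · simp
        · simpa using hN w (fun h => hw ⟨w, h, rfl⟩)
    refine ⟨Set.univ, Sum.elim a b, ?_, ?_, ?_⟩
    · rwa [Set.ncard_univ, Nat.card_sum]
    · rw [Set.ncard_univ, Nat.card_sum]; omega
    · exact fun u _ v _ huv => ⟨huv, fun w hw => absurd (Set.mem_univ w) hw⟩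
  | @join V G a i j hij _ ih =>
    refine ⟨ih.1, fun hc => ?_⟩
    obtain ⟨A, f, hA1, hA2, hf⟩ := ih.2 hc
    refine ⟨A, f, hA1, hA2, fun u hu v hv huv => ?_⟩
    obtain ⟨hl, hN⟩ := hf u hu v hv huv
    refine ⟨hl, fun w hw => ?_⟩
    have h1 : u ≠ w := fun h => hw (h ▸ hu)
    have h2 : v ≠ w := fun h => hw (h ▸ hv)
    simp [SimpleGraph.fromRel_adj, hN w hw, hl, h1, h2]
  | @rename V G a i j _ ih =>
    refine ⟨ih.1, fun hc => ?_⟩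
    obtain ⟨A, f, hA1, hA2, hf⟩ := ih.2 hc
    refine ⟨A, f, hA1, hA2, fun u hu v hv huv => ?_⟩
    obtain ⟨hl, hN⟩ := hf u hu v hv huv
    exact ⟨by simp [hl], hN⟩
  | @iso V W G H a φ _ ih =>
    obtain ⟨hV, ih⟩ := ih
    refine ⟨Finite.of_equiv V φ.toEquiv.symm, fun hc => ?_⟩
    rw [Nat.card_congr φ.toEquiv] at hc
    obtain ⟨A, f, hA1, hA2, hf⟩ := ih hc
    have hcard : (φ ⁻¹' A).ncard = A.ncard :=
      Set.ncard_preimage_of_injective_subset_range φ.injective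
        (by rw [φ.surjective.range_eq]; exact Set.subset_univ _)
    refine ⟨φ ⁻¹' A, f ∘ φ, by rwa [hcard], by rwa [hcard], fun u hu v hv huv => ?_⟩
    obtain ⟨hl, hN⟩ := hf _ hu _ hv huv
    refine ⟨hl, fun w hw => ?_⟩
    rw [← φ.map_adj_iff, ← φ.map_adj_iff]
    exact hN _ hw

/-! ### Powers of paths have large clique-width -/

/-- The `m`-th power of the path on `N` vertices. -/
def pathPower (N m : ℕ) : SimpleGraph (ULift.{u} (Fin N)) where
  Adj x y := x ≠ y ∧ (x.down : ℕ) ≤ y.down + m ∧ (y.down : ℕ) ≤ x.down + m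
  symm := ⟨fun _ _ h => ⟨h.1.symm, h.2.2, h.2.1⟩⟩
  loopless := ⟨fun _ h => h.1 rfl⟩

theorem Set.Icc_add_one_inter_nonempty_iff (a b : ℝ) :
    (Set.Icc a (a + 1) ∩ Set.Icc b (b + 1)).Nonempty ↔ a ≤ b + 1 ∧ b ≤ a + 1 := by
  rw [Set.Icc_inter_Icc, Set.nonempty_Icc, sup_le_iff, le_inf_iff, le_inf_iff]
  constructor
  · rintro ⟨⟨_, h⟩, h', _⟩; exact ⟨h, h'⟩
  · rintro ⟨h, h'⟩; exact ⟨⟨by linarith, h⟩, h', by linarith⟩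

theorem isUnitInterval_pathPower (N m : ℕ) (hm : 0 < m) :
    IsUnitInterval (pathPower.{u} N m) := by
  refine ⟨fun x => (x.down : ℕ) / m, fun x y => ?_⟩
  have hm' : (0 : ℝ) < m := by exact_mod_cast hm
  rw [Set.Icc_add_one_inter_nonempty_iff, div_add_one hm'.ne', div_add_one hm'.ne',
    div_le_div_iff_of_pos_right hm', div_le_div_iff_of_pos_right hm']
  show _ ∧ _ ↔ _
  norm_cast

/-- A path power of suitable size has no balanced cut with few neighbourhood types. -/
theorem not_exists_balanced_cut {c n m : ℕ} (hc : 1 ≤ c) (hn : n = c + 2) (hm : m = 6 * c + 1)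
    (A : Finset ℕ) (f : ℕ → ℕ)
    (hf : ∀ x ∈ A, f x < c) (hAN : ∀ x ∈ A, x < n * m)
    (h1 : 2 * c * n < A.card) (h2 : A.card ≤ 2 * (2 * c * n))
    (hN : ∀ x ∈ A, ∀ y ∈ A, f x = f y → ∀ w < n * m, w ∉ A →
      ((x ≤ w + m ∧ w ≤ x + m) ↔ (y ≤ w + m ∧ w ≤ y + m))) : False := by
  have card_le (D : Finset ℕ) (hD : D ⊆ A)
      (hinj : ∀ x ∈ D, ∀ y ∈ D, x < y → f x ≠ f y) : D.card ≤ c := by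
    have := Finset.card_le_card_of_injOn (s := D) (t := Finset.range c) f
      (fun x hx => by simpa using hf x (hD hx)) (fun x hx y hy hxy => by
        rcases lt_trichotomy x y with h | h | h
        · exact absurd hxy (hinj x hx y hy h)
        · exact h
        · exact absurd hxy.symm (hinj y hy x hx h))
    simpa using this
  -- For `x < y` in this set, `y + m` lies outside `A` and is adjacent to `y` but not to `x`, so the
  -- types differ. The next set is symmetric, with `x - m`.
  have hD1 := card_le (A.filter fun x => x + m < n * m ∧ x + m ∉ A) (Finset.filter_subset _ _) (by
    intro x hx y hy hxy he
    simp only [Finset.mem_filter] at hx hy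
    have := hN x hx.1 y hy.1 he (y + m) hy.2.1 hy.2.2
    omega)
  have hD2 := card_le (A.filter fun x => m ≤ x ∧ x - m ∉ A) (Finset.filter_subset _ _) (by
    intro x hx y hy hxy he
    simp only [Finset.mem_filter] at hx hy
    have hxN := hAN x hx.1
    have := hN x hx.1 y hy.1 he (x - m) (by omega) hx.2.2
    omega)
  set D1 := A.filter fun x => x + m < n * m ∧ x + m ∉ A with hD1d
  set D2 := A.filter fun x => m ≤ x ∧ x - m ∉ A with hD2d
  set bad := (D1 ∪ D2).image (· % m) with hbad
  have hbadc : bad.card ≤ 2 * c := by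
    have h3 : bad.card ≤ (D1 ∪ D2).card := Finset.card_image_le
    have := Finset.card_union_le D1 D2
    omega
  have hm0 : 0 < m := by omega
  have hlt : ∀ i < n, ∀ r < m, r + i * m < n * m := by
    intro i hi r hr
    have := Nat.mul_le_mul_right m (Nat.succ_le_of_lt hi)
    rw [Nat.succ_mul] at this
    omega
  have hmod : ∀ i, ∀ r < m, (r + i * m) % m = r := by
    intro i r hr
    rw [Nat.add_mul_mod_self_right, Nat.mod_eq_of_lt hr]
  -- Along a residue class mod `m` that is not bad, membership in `A` never changes, so the class
  -- lies inside `A` or misses it.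
  have step : ∀ r < m, r ∉ bad → ∀ i, i + 1 < n → (r + i * m ∈ A ↔ r + (i + 1) * m ∈ A) := by
    intro r hr hrb i hi
    have e : r + (i + 1) * m = r + i * m + m := by ring
    have hl := hlt (i + 1) hi r hr
    constructor
    · intro h
      by_contra h'
      refine hrb (Finset.mem_image.2 ⟨r + i * m, ?_, hmod i r hr⟩)
      rw [e] at h' hl
      exact Finset.mem_union_left _ (Finset.mem_filter.2 ⟨h, hl, h'⟩)
    · intro h
      by_contra h'
      refine hrb (Finset.mem_image.2 ⟨r + (i + 1) * m, ?_, hmod _ r hr⟩)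
      refine Finset.mem_union_right _ (Finset.mem_filter.2 ⟨h, by omega, ?_⟩)
      rwa [e, Nat.add_sub_cancel]
  have mono : ∀ r < m, r ∉ bad → ∀ i < n, (r + i * m ∈ A ↔ r ∈ A) := by
    intro r hr hrb i
    induction i with
    | zero => simp
    | succ i ih => intro hi; rw [← step r hr hrb i hi]; exact ih (by omega)
  have hBc : ((Finset.range (n * m)).filter fun x => x % m ∈ bad).card ≤ 2 * c * n := by
    have := Finset.card_le_card_of_injOn
      (s := (Finset.range (n * m)).filter fun x => x % m ∈ bad) (t := bad ×ˢ Finset.range n)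
      (fun x => (x % m, x / m))
      (fun x hx => by
        simp only [Finset.coe_filter, Set.mem_ofPred_eq, Finset.mem_range] at hx
        simpa using ⟨hx.2, Nat.div_lt_of_lt_mul (by rw [Nat.mul_comm]; exact hx.1)⟩)
      (fun x _ y _ hxy => by
        simp only [Prod.mk.injEq] at hxy
        rw [← Nat.mod_add_div x m, ← Nat.mod_add_div y m, hxy.1, hxy.2])
    rw [Finset.card_product, Finset.card_range] at this
    exact this.trans (Nat.mul_le_mul_right n hbadc)
  have hdiv : ∀ x < n * m, x % m < m ∧ x / m < n ∧ x = x % m + x / m * m := fun x hx =>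
    ⟨Nat.mod_lt _ hm0, Nat.div_lt_of_lt_mul (by rwa [Nat.mul_comm]),
      by rw [Nat.mul_comm]; exact (Nat.mod_add_div x m).symm⟩
  -- The bad classes hold at most `2 * c * n` numbers, fewer than `A` has.
  have hin : ∃ r < m, r ∉ bad ∧ r ∈ A := by
    by_contra! hcon
    have : A ⊆ (Finset.range (n * m)).filter fun x => x % m ∈ bad := by
      intro x hx
      have hxN := hAN x hx
      refine Finset.mem_filter.2 ⟨Finset.mem_range.2 hxN, ?_⟩
      by_contra hb
      obtain ⟨ha, hb', he⟩ := hdiv x hxN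
      refine hcon _ ha hb ((mono _ ha hb _ hb').1 ?_)
      rwa [← he]
    have := Finset.card_le_card this
    omega
  -- `A` and the bad classes together cover at most `6 * c * n` numbers, fewer than `n * m = 6 * c *
  -- n + n`.
  have hout : ∃ s < m, s ∉ bad ∧ s ∉ A := by
    by_contra! hcon
    have : Finset.range (n * m) ⊆ A ∪ (Finset.range (n * m)).filter fun x => x % m ∈ bad := by
      intro x hx
      rw [Finset.mem_union, or_iff_not_imp_right]
      intro hb
      have hxN := Finset.mem_range.1 hx
      have hb : x % m ∉ bad := fun h => hb (Finset.mem_filter.2 ⟨hx, h⟩)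
      obtain ⟨ha, hb', he⟩ := hdiv x hxN
      rw [he]
      exact (mono _ ha hb _ hb').2 (hcon _ ha hb)
    have h3 := (Finset.card_le_card this).trans (Finset.card_union_le _ _)
    rw [Finset.card_range] at h3
    have : n * m = 6 * c * n + n := by rw [hm]; ring
    have : 2 * (2 * c * n) + 2 * c * n = 6 * c * n := by ring
    omega
  obtain ⟨r, hr, hrb, hrA⟩ := hin
  obtain ⟨s, hs, hsb, hsA⟩ := hout
  have hrs : r ≠ s := fun h => hsA (h ▸ hrA)
  have hx : ∀ i < n, r + i * m ∈ A := fun i hi => (mono r hr hrb i hi).2 hrA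
  have hy : ∀ i < n, s + i * m ∉ A := fun i hi h => hsA ((mono s hs hsb i hi).1 h)
  -- The first element after `r + j * m` in the class of `s` is within distance `m` of it, but
  -- farther than `m` from `r + i * m`. So `c + 1` elements of `A` have distinct types; `n = c + 2`
  -- leaves room for the index `j + 1`.
  have key : ∀ i j, i < j → j < c + 1 → f (r + i * m) ≠ f (r + j * m) := by
    intro i j hij hj he
    have hmul := Nat.mul_le_mul_right m (Nat.succ_le_of_lt hij)
    rw [Nat.succ_mul] at hmul
    have e : (j + 1) * m = j * m + m := by ring
    rcases lt_or_gt_of_ne hrs with h | h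
    · have := hN _ (hx i (by omega)) _ (hx j (by omega)) he (s + j * m)
        (hlt j (by omega) s hs) (hy j (by omega))
      omega
    · have := hN _ (hx i (by omega)) _ (hx j (by omega)) he (s + (j + 1) * m)
        (hlt (j + 1) (by omega) s hs) (hy (j + 1) (by omega))
      omega
  have := Finset.card_le_card_of_injOn (s := Finset.range (c + 1)) (t := Finset.range c)
    (fun i => f (r + i * m))
    (fun i hi => by
      have hi := Finset.mem_range.1 (Finset.mem_coe.1 hi)
      simpa using hf _ (hx i (by omega)))
    (fun i hi j hj hij => by
      have hi := Finset.mem_range.1 (Finset.mem_coe.1 hi)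
      have hj := Finset.mem_range.1 (Finset.mem_coe.1 hj)
      rcases lt_trichotomy i j with h | h | h
      · exact absurd hij (key i j h hj)
      · exact h
      · exact absurd hij.symm (key j i h hi))
  simp at this

theorem exists_CWBuild_of_cliqueWidth_le {V : Type u} {G : SimpleGraph V} {c : ℕ}
    (h : cliqueWidth G ≤ c) : ∃ k ≤ c, ∃ lab : V → Fin k, CWBuild k G lab := by
  have h' : cliqueWidth G < ((c + 1 : ℕ) : ℕ∞) :=
    h.trans_lt (by exact_mod_cast Nat.lt_succ_self c)
  simp only [cliqueWidth, iInf_lt_iff] at h'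
  obtain ⟨k, hk, hlt⟩ := h'
  exact ⟨k, Nat.lt_succ_iff.1 (by exact_mod_cast hlt), hk⟩

theorem lt_cliqueWidth_pathPower (c : ℕ) (hc : 1 ≤ c) :
    (c : ℕ∞) < cliqueWidth (pathPower.{u} ((c + 2) * (6 * c + 1)) (6 * c + 1)) := by
  by_contra! hcon
  obtain ⟨k, hk, lab, h⟩ := exists_CWBuild_of_cliqueWidth_le hcon
  obtain ⟨-, h⟩ := h.exists_balanced_cut (2 * c * (c + 2)) (by nlinarith)
  obtain ⟨A, f, h1, h2, hf⟩ := h (by simp; nlinarith)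
  classical
  let g : ULift.{u} (Fin ((c + 2) * (6 * c + 1))) → ℕ := fun x => x.down
  have hg : Function.Injective g := fun x y h => ULift.ext _ _ (Fin.ext h)
  have hA : A.ncard = (A.toFinset.image g).card := by
    rw [Finset.card_image_of_injective _ hg, Set.ncard_eq_toFinset_card']
  have hinv : ∀ x, Function.extend g (fun x => (f x : ℕ)) 0 (g x) = f x := hg.extend_apply _ _
  rw [hA] at h1 h2
  refine not_exists_balanced_cut hc rfl rfl (A.toFinset.image g)
    (Function.extend g (fun x => (f x : ℕ)) 0) ?_ ?_ h1 h2 ?_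
  · intro x hx
    obtain ⟨x, -, rfl⟩ := Finset.mem_image.1 hx
    rw [hinv]
    exact (f x).2.trans_le hk
  · intro x hx
    obtain ⟨x, -, rfl⟩ := Finset.mem_image.1 hx
    exact x.down.2
  · intro x hx y hy hxy w hw hwA
    obtain ⟨x, hx', rfl⟩ := Finset.mem_image.1 hx
    obtain ⟨y, hy', rfl⟩ := Finset.mem_image.1 hy
    rw [hinv, hinv] at hxy
    rw [Set.mem_toFinset] at hx' hy'
    have hw' : (⟨⟨w, hw⟩⟩ : ULift.{u} (Fin _)) ∉ A := fun h =>
      hwA (Finset.mem_image.2 ⟨_, Set.mem_toFinset.2 h, rfl⟩)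
    have := (hf x hx' y hy' (Fin.ext hxy)).2 _ hw'
    have hxw : x ≠ ⟨⟨w, hw⟩⟩ := fun h => hw' (h ▸ hx')
    have hyw : y ≠ ⟨⟨w, hw⟩⟩ := fun h => hw' (h ▸ hy')
    simpa [pathPower, hxw, hyw] using this

theorem not_hasBoundedCliqueWidth_unitIntervalGraphs :
    ¬ HasBoundedCliqueWidth unitIntervalGraphs.{u} := by
  rintro ⟨c, hc⟩
  have : Nonempty (ULift.{u} (Fin ((c + 1 + 2) * (6 * (c + 1) + 1)))) :=
    ⟨⟨⟨0, by positivity⟩⟩⟩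
  have h := hc ⟨_, pathPower.{u} ((c + 1 + 2) * (6 * (c + 1) + 1)) (6 * (c + 1) + 1)⟩
    (isUnitInterval_pathPower _ _ (by omega))
  have h2 := lt_cliqueWidth_pathPower.{u} (c + 1) (by omega)
  have h3 := h2.trans_le h
  norm_cast at h3
  omega

theorem isHereditary_unitIntervalGraphs : IsHereditary unitIntervalGraphs.{u} := by
  rintro G ⟨l, hl⟩ H ⟨φ⟩
  refine ⟨l ∘ φ, fun u v => ?_⟩
  rw [← φ.map_adj_iff, hl, φ.injective.ne_iff]
  rfl

/-! ### Building a graph vertex by vertex -/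

theorem CWBuild.join_finset {k : ℕ} {V : Type u} {G : SimpleGraph V} {a : V → Fin k}
    (h : CWBuild k G a) (j : Fin k) (S : Finset (Fin k)) (hj : j ∉ S) :
    CWBuild k (G ⊔ SimpleGraph.fromRel (fun u v => a u ∈ S ∧ a v = j)) a := by
  induction S using Finset.induction_on with
  | empty =>
    have : SimpleGraph.fromRel (fun u v => a u ∈ (∅ : Finset (Fin k)) ∧ a v = j) = ⊥ := by
      ext; simp
    rwa [this, sup_bot_eq]
  | insert i S _ ih =>
    rw [Finset.mem_insert, not_or] at hj
    have h' := CWBuild.join i j (Ne.symm hj.1) (ih hj.2)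
    convert h' using 1
    ext u v
    simp only [SimpleGraph.sup_adj, SimpleGraph.fromRel_adj, Finset.mem_insert]
    tauto

/-- The new vertex enters with a label unused on `A` and is joined to the labels of its neighbours;
this adds no wrong edge since equally labelled vertices agree on `v`. -/
theorem CWBuild.insert_vertex {k : ℕ} {V : Type u} {G : SimpleGraph V} {A : Set V} {c : V → Fin k}
    (h : CWBuild k (G.induce A) (fun x => c x)) {v : V} (hv : v ∉ A) {j : Fin k}
    (hj : ∀ u ∈ A, c u ≠ j) (hc : ∀ u ∈ A, ∀ w ∈ A, c u = c w → (G.Adj u v ↔ G.Adj w v))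
    (hcv : c v = j) :
    CWBuild k (G.induce (insert v A)) (fun x => c x) := by
  classical
  let S : Finset (Fin k) := Finset.univ.filter fun i => ∃ u ∈ A, c u = i ∧ G.Adj u v
  have hS : ∀ u ∈ A, (c u ∈ S ↔ G.Adj u v) := by
    intro u hu
    simp only [S, Finset.mem_filter, Finset.mem_univ, true_and]
    constructor
    · rintro ⟨w, hw, e, ha⟩
      exact (hc w hw u hu e).1 ha
    · intro ha
      exact ⟨u, hu, rfl, ha⟩
  have hjS : j ∉ S := by
    simp only [S, Finset.mem_filter, Finset.mem_univ, true_and]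
    rintro ⟨w, hw, e, -⟩
    exact hj w hw e
  have h2 := (CWBuild.union h (CWBuild.vertex j)).join_finset j S hjS
  let e : ↥(insert v A) ≃ ↥A ⊕ PUnit.{u + 1} := Equiv.Set.insert hv
  have hesymm : ∀ x : ↥A ⊕ PUnit.{u + 1}, (e.symm x : V) = Sum.elim (fun a : A => (a : V)) (fun _ => v) x := by
    rintro (x | x)
    · exact congrArg Subtype.val (Equiv.Set.insert_symm_apply_inl hv x)
    · exact congrArg Subtype.val (Equiv.Set.insert_symm_apply_inr hv x)
  have key : ∀ x y, (((G.induce A) ⊕g (⊥ : SimpleGraph PUnit.{u + 1})) ⊔ SimpleGraph.fromRel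
      (fun u w => Sum.elim (fun x : A => c x) (fun _ => j) u ∈ S ∧
        Sum.elim (fun x : A => c x) (fun _ => j) w = j)).Adj x y ↔
      (G.induce (insert v A)).Adj (e.symm x) (e.symm y) := by
    intro x y
    rw [SimpleGraph.comap_adj]
    simp only [Function.Embedding.subtype_apply, hesymm]
    rcases x with x | x <;> rcases y with y | y
    · simp [SimpleGraph.fromRel_adj, hj]
    · simp [SimpleGraph.fromRel_adj, hjS, hS]
    · simp [SimpleGraph.fromRel_adj, hjS, hS, G.adj_comm]
    · simp
  have h3 := CWBuild.iso (H := G.induce (insert v A)) ⟨e, fun {a b} => by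
    rw [key]; simp⟩ h2
  convert h3 using 1
  ext x
  obtain ⟨y, rfl⟩ := e.symm.surjective x
  rcases y with y | y
  · simp [hesymm]
  · simp [hesymm, hcv]

/-- Renaming one label to another with equivalent vertices reduces the number of labels in use, so
repetition terminates. -/
theorem CWBuild.exists_merge {k : ℕ} {V : Type u} {G : SimpleGraph V} {A : Set V} (R : Setoid V)
    {c : V → Fin k} (h : CWBuild k (G.induce A) (fun x => c x))
    (hR : ∀ u ∈ A, ∀ v ∈ A, c u = c v → R u v) :
    ∃ c' : V → Fin k, CWBuild k (G.induce A) (fun x => c' x) ∧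
      ∀ u ∈ A, ∀ v ∈ A, (c' u = c' v ↔ R u v) := by
  induction hN : (c '' A).ncard using Nat.strong_induction_on generalizing c with
  | _ N ih =>
    by_cases hall : ∀ u ∈ A, ∀ v ∈ A, R u v → c u = c v
    · exact ⟨c, h, fun u hu v hv => ⟨hR u hu v hv, hall u hu v hv⟩⟩
    push Not at hall
    obtain ⟨u, hu, v, hv, huv, hne⟩ := hall
    refine ih _ ?_ (CWBuild.rename (c u) (c v) h) ?_ rfl (c := fun x => if c x = c u then c v else c x)
    · rw [← hN]
      refine Set.ncard_lt_ncard ?_ (Set.toFinite _)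
      refine ⟨?_, fun hsub => ?_⟩
      · rintro _ ⟨x, hx, rfl⟩
        dsimp only
        split_ifs
        · exact ⟨v, hv, rfl⟩
        · exact ⟨x, hx, rfl⟩
      · obtain ⟨x, hx, hxe⟩ := hsub ⟨u, hu, rfl⟩
        dsimp only at hxe
        split_ifs at hxe with h'
        · exact hne hxe.symm
        · exact h' hxe
    · intro x hx y hy hxy
      split_ifs at hxy with h1 h2 h2
      · exact hR x hx y hy (h1.trans h2.symm)
      · exact R.trans (hR x hx u hu h1) (R.trans huv (hR v hv y hy hxy))
      · exact R.trans (hR x hx v hv hxy) (R.trans (R.symm huv) (hR u hu y hy h2.symm))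
      · exact hR x hx y hy hxy

/-- Vertices with the same neighbours outside `A`. -/
def SimpleGraph.outerSetoid {V : Type u} (G : SimpleGraph V) (A : Set V) : Setoid V where
  r u v := ∀ w ∉ A, (G.Adj u w ↔ G.Adj v w)
  iseqv := ⟨fun _ _ _ => Iff.rfl, fun h w hw => (h w hw).symm,
    fun h h' w hw => (h w hw).trans (h' w hw)⟩

/-- After each insertion, labels are merged until they are exactly the outer neighbourhood classes
of the initial segment. There are at most `Fintype.card T` of these, and one more label is kept for
the next vertex. -/
theorem exists_CWBuild_of_ordering {V : Type u} [Finite V] [Nonempty V] (G : SimpleGraph V)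
    {α : Type*} [LinearOrder α] (key : V → α) (hkey : Function.Injective key) (T : Type*)
    [Fintype T] (hT : ∀ a : V, ∃ f : V → T, ∀ u v, key u < key a → key v < key a → f u = f v →
      ∀ w, key a ≤ key w → (G.Adj u w ↔ G.Adj v w)) :
    ∃ lab : V → Fin (Fintype.card T + 1), CWBuild (Fintype.card T + 1) G lab := by
  classical
  have := Fintype.ofFinite V
  have main : ∀ s : Finset V, s.Nonempty → (∀ x ∈ s, ∀ y, key y ≤ key x → y ∈ s) →
      ∃ c : V → Fin (Fintype.card T + 1),
        CWBuild _ (G.induce (s : Set V)) (fun x => c x) ∧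
        ∀ u ∈ s, ∀ v ∈ s, (c u = c v ↔ G.outerSetoid s u v) := by
    intro s
    induction s using Finset.induction_on_max_value (f := key) with
    | empty => simp
    | insert a s has hmax ih =>
      intro _ hlow
      have hs : ∀ y, y ∈ s ↔ key y < key a := by
        intro y
        constructor
        · intro hy
          exact lt_of_le_of_ne (hmax y hy) (fun h => has (hkey h ▸ hy))
        · intro hy
          rcases Finset.mem_insert.1 (hlow a (Finset.mem_insert_self _ _) y hy.le) with h | h
          · exact absurd hy (h ▸ lt_irrefl _)
          · exact h
      have build : ∃ c : V → Fin (Fintype.card T + 1),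
          CWBuild _ (G.induce ((insert a s : Finset V) : Set V)) (fun x => c x) ∧
          ∀ u ∈ (insert a s : Finset V), ∀ v ∈ (insert a s : Finset V), c u = c v →
            G.outerSetoid ((insert a s : Finset V) : Set V) u v := by
        rcases s.eq_empty_or_nonempty with rfl | hne
        · refine ⟨fun _ => 0, ?_, ?_⟩
          · have e : ↥((insert a ∅ : Finset V) : Set V) ≃ PUnit.{u + 1} :=
              { toFun := fun _ => PUnit.unit
                invFun := fun _ => ⟨a, by simp⟩
                left_inv := fun ⟨x, hx⟩ => by
                  simp at hx; simp [hx]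
                right_inv := fun _ => rfl }
            refine CWBuild.iso (H := G.induce ((insert a ∅ : Finset V) : Set V)) ⟨e, ?_⟩
              (CWBuild.vertex 0)
            rintro ⟨x, hx⟩ ⟨y, hy⟩
            simp at hx hy
            subst hx hy
            simp
          · intro u hu v hv _
            simp at hu hv
            subst hu hv
            exact Setoid.refl' _ _
        · obtain ⟨c, hc, hcs⟩ := ih hne (fun x hx y hy => (hs y).2 (hy.trans_lt ((hs x).1 hx)))
          obtain ⟨f, hf⟩ := hT a
          have hfs : ∀ u ∈ s, ∀ v ∈ s, f u = f v → c u = c v := by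
            intro u hu v hv huv
            refine (hcs u hu v hv).2 fun w hw => hf u v ((hs u).1 hu) ((hs v).1 hv) huv w ?_
            exact le_of_not_gt fun h => hw ((hs w).2 h)
          obtain ⟨j, hj⟩ : ∃ j, ∀ u ∈ s, c u ≠ j := by
            by_contra! hcon
            choose g hg hg' using hcon
            have hinj : Function.Injective (f ∘ g) := by
              intro i i' hii
              rw [← hg' i, ← hg' i']
              exact hfs _ (hg i) _ (hg i') hii
            simpa using Fintype.card_le_of_injective _ hinj
          have hupd : ∀ u ∈ s, Function.update c a j u = c u := fun u hu =>
            Function.update_of_ne (ne_of_mem_of_not_mem hu has) _ _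
          have hc' : CWBuild _ (G.induce (s : Set V)) (fun x => Function.update c a j x) := by
            convert hc using 1
            ext x
            rw [hupd x x.2]
          refine ⟨Function.update c a j, ?_, ?_⟩
          · have := hc'.insert_vertex (v := a) (j := j) (by simpa using has)
              (fun u hu => by rw [hupd u hu]; exact hj u hu)
              (fun u hu w hw huw => by
                rw [hupd u hu, hupd w hw] at huw
                exact (hcs u hu w hw).1 huw a (by simpa using has))
              (by simp)
            rwa [Finset.coe_insert]
          · intro u hu v hv huv
            rcases Finset.mem_insert.1 hu with rfl | hu' <;>
              rcases Finset.mem_insert.1 hv with rfl | hv'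
            · exact Setoid.refl' _ _
            · rw [hupd v hv', Function.update_self] at huv
              exact absurd huv.symm (hj v hv')
            · rw [hupd u hu', Function.update_self] at huv
              exact absurd huv (hj u hu')
            · rw [hupd u hu', hupd v hv'] at huv
              intro w hw
              exact (hcs u hu' v hv').1 huv w (fun h => hw (by
                rw [Finset.coe_insert]; exact Or.inr h))
      obtain ⟨c, hc, hcs⟩ := build
      obtain ⟨c', h1, h2⟩ := hc.exists_merge (G.outerSetoid _)
        (fun u hu v hv => hcs u (by exact_mod_cast hu) v (by exact_mod_cast hv))
      exact ⟨c', h1, fun u hu v hv => h2 u (by exact_mod_cast hu) v (by exact_mod_cast hv)⟩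
  obtain ⟨c, hc, -⟩ := main Finset.univ Finset.univ_nonempty (by simp)
  refine ⟨c, ?_⟩
  rw [Finset.coe_univ] at hc
  exact CWBuild.iso (SimpleGraph.induceUnivIso G).symm hc

theorem cliqueWidth_le_of_ordering {V : Type u} [Finite V] [Nonempty V] (G : SimpleGraph V)
    {α : Type*} [LinearOrder α] (key : V → α) (hkey : Function.Injective key) (T : Type*)
    [Fintype T] (hT : ∀ a : V, ∃ f : V → T, ∀ u v, key u < key a → key v < key a → f u = f v →
      ∀ w, key a ≤ key w → (G.Adj u w ↔ G.Adj v w)) :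
    cliqueWidth G ≤ (Fintype.card T + 1 : ℕ) :=
  iInf₂_le (Fintype.card T + 1) (exists_CWBuild_of_ordering G key hkey T hT)

/-! ### Grid models of unit interval graphs -/

/-- A representation of a graph by points of a grid: every column is a clique, and a point is
adjacent to the points of the next column that lie in a lower row. -/
structure IsGridModel {V : Type u} (G : SimpleGraph V) (col row : V → ℕ) : Prop where
  row_injective : Function.Injective row
  adj_iff : ∀ u v, G.Adj u v ↔ u ≠ v ∧ (col u = col v ∨ (col v = col u + 1 ∧ row v < row u) ∨
    (col u = col v + 1 ∧ row u < row v))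

/-- The graph of all points of an `n` by `m` grid. -/
def gridGraph (n m : ℕ) : SimpleGraph (Fin n × Fin m) where
  Adj p q := p ≠ q ∧ (p.1 = q.1 ∨ ((q.1 : ℕ) = p.1 + 1 ∧ q.2 < p.2) ∨
    ((p.1 : ℕ) = q.1 + 1 ∧ p.2 < q.2))
  symm := ⟨fun _ _ h => ⟨h.1.symm, by rcases h.2 with h | h | h <;> simp [h]⟩⟩
  loopless := ⟨fun _ h => h.1 rfl⟩

theorem exists_nat_rank {V : Type u} [Finite V] {α : Type*} [LinearOrder α] (key : V → α) :
    ∃ row : V → ℕ, ∀ u v, row u < row v ↔ key u < key v := by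
  have hlt : ∀ u v, key u < key v → {w | key w < key u}.ncard < {w | key w < key v}.ncard := by
    intro u v huv
    refine Set.ncard_lt_ncard ⟨fun w hw => lt_trans hw huv, fun h => ?_⟩ (Set.toFinite _)
    exact lt_irrefl _ (h huv)
  have hle : ∀ u v, key u ≤ key v → {w | key w < key u}.ncard ≤ {w | key w < key v}.ncard :=
    fun u v huv => Set.ncard_le_ncard (fun w hw => lt_of_lt_of_le hw huv) (Set.toFinite _)
  refine ⟨fun v => {w | key w < key v}.ncard, fun u v => ⟨fun h => ?_, hlt u v⟩⟩
  by_contra h'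
  exact absurd (hle v u (not_lt.1 h')) (not_le.2 h)

theorem IsUnitInterval.exists_isGridModel {V : Type u} [Finite V] {G : SimpleGraph V}
    (h : IsUnitInterval G) : ∃ col row : V → ℕ, IsGridModel G col row := by
  obtain ⟨l, hl⟩ := h
  obtain ⟨C, hC⟩ : ∃ C : ℝ, ∀ v, 0 ≤ l v + C := by
    obtain ⟨b, hb⟩ := (Set.finite_range l).bddBelow
    exact ⟨-b, fun v => by linarith [hb ⟨v, rfl⟩]⟩
  obtain ⟨N, ⟨e⟩⟩ := Finite.exists_equiv_fin V
  let col : V → ℕ := fun v => ⌊l v + C⌋₊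
  let fr : V → ℝ := fun v => l v + C - col v
  -- Closed intervals that touch at an endpoint intersect, so among equal fractional parts the
  -- larger column must get the lower row; `e` breaks the remaining ties.
  obtain ⟨row, hrow⟩ := exists_nat_rank
    (fun v => toLex (fr v, toLex (-(col v : ℤ), e v)) : V → ℝ ×ₗ (ℤ ×ₗ Fin N))
  have hfr : ∀ v, 0 ≤ fr v ∧ fr v < 1 := fun v =>
    ⟨sub_nonneg.2 (Nat.floor_le (hC v)), by
      have := Nat.lt_floor_add_one (l v + C)
      simp only [fr, col]; linarith⟩
  have hlv : ∀ v, l v = fr v + col v - C := fun v => by simp only [fr]; ring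
  have hcols : ∀ u v, col v = col u + 1 → (row v < row u ↔ fr v ≤ fr u) := by
    intro u v huv
    rw [hrow, Prod.Lex.toLex_lt_toLex, le_iff_lt_or_eq]
    refine or_congr_right (and_iff_left ?_)
    rw [Prod.Lex.toLex_lt_toLex]
    left
    simp only [huv]; push_cast; linarith
  refine ⟨col, row, ?_, fun u v => ?_⟩
  · intro u v huv
    have h1 := (hrow u v).not.1 huv.not_lt
    have h2 := (hrow v u).not.1 huv.not_gt
    have := le_antisymm (not_lt.1 h2) (not_lt.1 h1)
    simpa using congrArg (fun x => (ofLex (ofLex x).2).2) this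
  · rw [hl, Set.Icc_add_one_inter_nonempty_iff]
    refine and_congr_right fun _ => ?_
    obtain ⟨hu0, hu1⟩ := hfr u
    obtain ⟨hv0, hv1⟩ := hfr v
    have e1 : (col v = col u + 1 ∧ row v < row u) ↔ (col v = col u + 1 ∧ fr v ≤ fr u) :=
      and_congr_right fun h => hcols u v h
    have e2 : (col u = col v + 1 ∧ row u < row v) ↔ (col u = col v + 1 ∧ fr u ≤ fr v) :=
      and_congr_right fun h => hcols v u h
    rw [e1, e2, hlv u, hlv v]
    constructor
    · rintro ⟨h1, h2⟩
      have h3 : (col u : ℝ) < col v + 2 := by linarith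
      have h4 : (col v : ℝ) < col u + 2 := by linarith
      have h3 : col u < col v + 2 := by exact_mod_cast h3
      have h4 : col v < col u + 2 := by exact_mod_cast h4
      rcases lt_trichotomy (col u) (col v) with h | h | h
      · have hh : col v = col u + 1 := by omega
        refine Or.inr (Or.inl ⟨hh, ?_⟩)
        rw [hh] at h2; push_cast at h2; linarith
      · exact Or.inl h
      · have hh : col u = col v + 1 := by omega
        refine Or.inr (Or.inr ⟨hh, ?_⟩)
        rw [hh] at h1; push_cast at h1; linarith
    · rintro (h | ⟨h, h'⟩ | ⟨h, h'⟩) <;> rw [h] <;> push_cast <;> constructor <;> linarith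

theorem IsGridModel.exists_embedding_gridGraph {V : Type u} [Finite V] {G : SimpleGraph V}
    {col row : V → ℕ} (h : IsGridModel G col row) :
    ∃ n m, 2 ≤ n ∧ Nonempty (G ↪g gridGraph n m) := by
  obtain ⟨b, hb⟩ := (Set.finite_range col).bddAbove
  obtain ⟨b', hb'⟩ := (Set.finite_range row).bddAbove
  -- `b + 2` rather than `b + 1` guarantees at least two columns.
  have hc : ∀ v, col v < b + 2 := fun v => Nat.lt_succ_of_le ((hb ⟨v, rfl⟩).trans (Nat.le_succ b))
  have hr : ∀ v, row v < b' + 1 := fun v => Nat.lt_succ_of_le (hb' ⟨v, rfl⟩)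
  have key : ∀ u v, (gridGraph (b + 2) (b' + 1)).Adj (⟨col u, hc u⟩, ⟨row u, hr u⟩)
      (⟨col v, hc v⟩, ⟨row v, hr v⟩) ↔ G.Adj u v := by
    intro u v
    have : (col u = col v ∧ row u = row v) ↔ u = v :=
      ⟨fun e => h.row_injective e.2, fun e => by simp [e]⟩
    simp only [gridGraph, h.adj_iff, ne_eq, Prod.mk.injEq, Fin.mk.injEq, Fin.mk_lt_mk, this]
  refine ⟨b + 2, b' + 1, by omega,
    ⟨⟨⟨fun v => (⟨col v, hc v⟩, ⟨row v, hr v⟩), fun u v huv => ?_⟩, key _ _⟩⟩⟩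
  simp only [Prod.mk.injEq, Fin.mk.injEq] at huv
  exact h.row_injective huv.2

/-! ### Staircases in graphs without a large grid -/

open Classical in
/-- The number of terms of the sequence `σ` of columns that a scan of the rows below `r` meets in
this order. -/
noncomputable def scanCount {V : Type u} (col row : V → ℕ) (σ : ℕ → ℕ) : ℕ → ℕ
  | 0 => 0
  | r + 1 => if ∃ v, row v = r ∧ col v = σ (scanCount col row σ r) then scanCount col row σ r + 1
      else scanCount col row σ r

section scan

variable {V : Type u} (col row : V → ℕ) (σ : ℕ → ℕ)

theorem scanCount_mono : Monotone (scanCount col row σ) := by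
  refine monotone_nat_of_le_succ fun r => ?_
  rw [scanCount]
  split_ifs <;> omega

theorem exists_of_lt_scanCount {j r : ℕ} (h : j < scanCount col row σ r) :
    ∃ v, scanCount col row σ (row v + 1) = j + 1 ∧ col v = σ j := by
  induction r with
  | zero => simp [scanCount] at h
  | succ r ih =>
    by_cases hj : j < scanCount col row σ r
    · exact ih hj
    have h' := h
    rw [scanCount] at h'
    split_ifs at h' with hv
    · obtain ⟨v, rfl, hv2⟩ := hv
      have e : scanCount col row σ (row v) = j := by omega
      refine ⟨v, ?_, by rw [← e]; exact hv2⟩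
      rw [scanCount, if_pos ⟨v, rfl, hv2⟩, e]
    · exact absurd h' hj

theorem col_ne_of_scanCount (hrow : Function.Injective row) (hσ : ∀ j, σ j ≠ σ (j + 1)) (v : V) :
    col v ≠ σ (scanCount col row σ (row v + 1)) := by
  rw [scanCount]
  split_ifs with h
  · obtain ⟨w, hw, hw'⟩ := h
    rw [← hrow hw, ← hrow hw] at *
    rw [hw']
    exact hσ _
  · exact fun e => h ⟨v, rfl, e⟩

end scan

/-- Without a large grid, the columns `w * n, …, w * n + n - 1` can be separated by a staircase. -/
theorem IsGridModel.exists_staircase {V : Type u} [Nonempty V] {G : SimpleGraph V} {col row : V → ℕ}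
    (h : IsGridModel G col row) {n m : ℕ} (hn : 2 ≤ n) (hG : IsEmpty (gridGraph n m ↪g G))
    (w : ℕ) : ∃ p : ℕ → ℕ, Monotone p ∧ (∀ r, p r < n * m) ∧
      ∀ v, col v ≠ w * n + p (row v) % n := by
  -- Consecutive terms differ because `2 ≤ n`. Hence after a hit in a row, the column sought next is
  -- again missed by that row's vertex; this is why the staircase is read off at `r + 1`.
  have hσ : ∀ j, w * n + j % n ≠ w * n + (j + 1) % n := by
    intro j hj
    have h1 : j % n = (j + 1) % n := by omega
    have h2 : (j + 1) ≡ j + 0 [MOD n] := h1.symm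
    have h3 := Nat.ModEq.add_left_cancel' j h2
    have := (Nat.modEq_zero_iff_dvd.1 h3)
    have := Nat.le_of_dvd one_pos this
    omega
  refine ⟨fun r => scanCount col row (fun j => w * n + j % n) (r + 1),
    fun a b hab => scanCount_mono _ _ _ (by omega), fun r => ?_,
    col_ne_of_scanCount col row _ h.row_injective hσ⟩
  -- A scan that advances `n * m` times has passed cyclically through the `n` columns `m` times; its
  -- hits form an induced `gridGraph n m`, the hit numbered `i * n + c` being the point in column
  -- `c` and row `i`.
  by_contra! hcon
  have hex : ∀ j < n * m, _ := fun j hj =>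
    exists_of_lt_scanCount col row (fun j => w * n + j % n) (hj.trans_le hcon)
  choose! y hy2 hy3 using hex
  have hylt : ∀ i j, i < n * m → j < n * m → i < j → row (y i) < row (y j) := by
    intro i j hi hj hij
    by_contra! hle
    have := scanCount_mono col row (fun j => w * n + j % n) (Nat.succ_le_succ hle)
    rw [Nat.succ_eq_add_one, Nat.succ_eq_add_one, hy2 i hi, hy2 j hj] at this
    omega
  have hyiff : ∀ i j, i < n * m → j < n * m → (row (y i) < row (y j) ↔ i < j) := by
    intro i j hi hj
    refine ⟨fun hr => ?_, hylt i j hi hj⟩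
    rcases lt_trichotomy i j with h | h | h
    · exact h
    · rw [h] at hr; omega
    · have := hylt j i hj hi h; omega
  have hb : ∀ q : Fin n × Fin m, (q.2 : ℕ) * n + q.1 < n * m := by
    intro q
    have := Nat.mul_le_mul_right n (Nat.succ_le_of_lt q.2.2)
    rw [Nat.succ_mul, Nat.mul_comm m n] at this
    have := q.1.2
    omega
  have hcol : ∀ q : Fin n × Fin m, col (y ((q.2 : ℕ) * n + q.1)) = w * n + q.1 := by
    intro q
    rw [hy3 _ (hb q), Nat.mul_add_mod_self_right, Nat.mod_eq_of_lt q.1.2]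
  have hinj : Function.Injective fun q : Fin n × Fin m => y ((q.2 : ℕ) * n + q.1) := by
    intro q q' hq
    dsimp only at hq
    have h1 : (q.1 : ℕ) = q'.1 := by
      have := hcol q; rw [hq, hcol q'] at this; omega
    have h2 : (q.2 : ℕ) * n + q.1 = (q'.2 : ℕ) * n + q'.1 := by
      have a1 := (hyiff _ _ (hb q) (hb q')).not.1 (by rw [hq]; omega)
      have a2 := (hyiff _ _ (hb q') (hb q)).not.1 (by rw [hq]; omega)
      omega
    have h3 : (q.2 : ℕ) * n = (q'.2 : ℕ) * n := by omega
    exact Prod.ext (Fin.ext h1) (Fin.ext (Nat.eq_of_mul_eq_mul_right (by omega) h3))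
  refine hG.false ⟨⟨fun q => y ((q.2 : ℕ) * n + q.1), hinj⟩, fun {q q'} => ?_⟩
  rw [h.adj_iff]
  simp only [Function.Embedding.coeFn_mk]
  rw [hinj.ne_iff, hcol, hcol, hyiff _ _ (hb _) (hb _), hyiff _ _ (hb _) (hb _)]
  have hlt : ∀ a b c d : ℕ, c = d + 1 → (a * n + c < b * n + d ↔ a < b) := by
    intro a b c d hcd
    constructor
    · intro hlt
      by_contra! hba
      have := Nat.mul_le_mul_right n hba
      omega
    · intro hab
      have := Nat.mul_le_mul_right n (Nat.succ_le_of_lt hab)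
      rw [Nat.succ_mul] at this
      omega
  refine and_congr_right fun _ => or_congr ?_ (or_congr ?_ ?_)
  · rw [Fin.ext_iff]; omega
  · rw [show (w * n + (q'.1 : ℕ) = w * n + q.1 + 1) ↔ ((q'.1 : ℕ) = q.1 + 1) by omega]
    exact and_congr_right fun e => hlt _ _ _ _ e
  · rw [show (w * n + (q.1 : ℕ) = w * n + q'.1 + 1) ↔ ((q.1 : ℕ) = q'.1 + 1) by omega]
    exact and_congr_right fun e => hlt _ _ _ _ e

/-- Across a staircase, adjacency depends on the column and the step only. -/
theorem IsGridModel.adj_iff_of_staircase {V : Type u} {G : SimpleGraph V} {col row : V → ℕ}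
    (h : IsGridModel G col row) {n b : ℕ} {p : ℕ → ℕ} (hp : Monotone p) {u u' w : V}
    (hu : col u < b + p (row u) % n) (hu' : col u' < b + p (row u') % n)
    (hw : b + p (row w) % n < col w) (hcol : col u = col u') (hpu : p (row u) = p (row u')) :
    G.Adj u w ↔ G.Adj u' w := by
  have hlt : ∀ x y : V, p (row x) < p (row y) → row x < row y := fun x y => hp.reflect_lt
  have hne : ∀ x : V, col x < b + p (row x) % n → x ≠ w := by
    rintro x hx rfl; omega
  rw [h.adj_iff, h.adj_iff, and_iff_right (hne u hu), and_iff_right (hne u' hu'), ← hcol]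
  rcases lt_trichotomy (p (row u)) (p (row w)) with hc | hc | hc
  · have h1 := hlt u w hc
    have h2 := hlt u' w (hpu ▸ hc)
    have h3 : ¬ row w < row u := by omega
    have h4 : ¬ row w < row u' := by omega
    simp [h1, h2, h3, h4]
  -- On the same step, the staircase's column lies strictly between the two columns, so these differ
  -- by at least two.
  · have : ∀ q, (col u = col w ∨ (col w = col u + 1 ∧ row w < q) ∨
        (col u = col w + 1 ∧ q < row w)) → False := by
      rw [hc] at hu; omega
    exact ⟨fun h => (this _ h).elim, fun h => (this _ h).elim⟩
  · have h1 := hlt w u hc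
    have h2 := hlt w u' (hpu ▸ hc)
    have h3 : ¬ row u < row w := by omega
    have h4 : ¬ row u' < row w := by omega
    simp [h1, h2, h3, h4]

/-! ### Bounded clique-width by sweeping between staircases -/

theorem IsGridModel.cliqueWidth_le {V : Type u} [Finite V] [Nonempty V] {G : SimpleGraph V}
    {col row : V → ℕ} (h : IsGridModel G col row) {n m : ℕ} (hn : 2 ≤ n)
    (hG : IsEmpty (gridGraph n m ↪g G)) :
    cliqueWidth G ≤
      (Fintype.card (Bool × Bool × Fin (2 * n) × Fin (n * m) × Fin (n * m)) + 1 : ℕ) := by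
  classical
  choose p hp hpb hpc using h.exists_staircase hn hG
  let miss : ℕ → V → ℕ := fun w v => w * n + p w (row v) % n
  have hmiss : ∀ w v, w * n ≤ miss w v ∧ miss w v < w * n + n := fun w v =>
    ⟨Nat.le_add_right _ _, Nat.add_lt_add_left (Nat.mod_lt _ (by omega)) _⟩
  -- The cell number: `s v = k` places `v` right of staircase `k - 1` (if `0 < k`) and left of
  -- staircase `k`.
  let s : V → ℕ := fun v => col v / n + if col v < miss (col v / n) v then 0 else 1
  have hdiv : ∀ v, col v / n * n ≤ col v ∧ col v < col v / n * n + n := fun v => by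
    have h1 := Nat.div_add_mod (col v) n
    have h2 := Nat.mod_lt (col v) (show 0 < n by omega)
    rw [Nat.mul_comm] at h1
    omega
  have hmul : ∀ a b : ℕ, a < b → a * n + n ≤ b * n := fun a b hab => by
    have := Nat.mul_le_mul_right n (Nat.succ_le_of_lt hab)
    rwa [Nat.succ_mul] at this
  have hleft : ∀ k v, s v ≤ k → col v < miss k v := by
    intro k v hk
    have h1 := hdiv v
    have h2 := hmiss k v
    rcases Nat.lt_or_ge (col v / n) k with hlt | hge
    · have := hmul _ _ hlt; omega
    · simp only [s] at hk
      split_ifs at hk with hc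
      · rwa [show k = col v / n by omega]
      · omega
  have hright : ∀ k v, k < s v → miss k v < col v := by
    intro k v hk
    have h1 := hdiv v
    have h2 := hmiss k v
    rcases Nat.lt_or_ge k (col v / n) with hlt | hge
    · have := hmul _ _ hlt; omega
    · simp only [s] at hk
      split_ifs at hk with hc
      · omega
      · obtain rfl : col v / n = k := by omega
        exact lt_of_le_of_ne (not_lt.1 hc) (hpc _ v).symm
  have hwin : ∀ v, s v * n ≤ col v + n ∧ col v < s v * n + n := by
    intro v
    have h1 := hdiv v
    simp only [s]
    split_ifs
    · rw [Nat.add_zero]; omega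
    · rw [Nat.succ_mul]; omega
  have hmod : ∀ x y a : ℕ, a ≤ x + n → a ≤ y + n → x < a + n → y < a + n →
      x % (2 * n) = y % (2 * n) → x = y := by
    intro x y a h1 h2 h3 h4 h5
    wlog hxy : x ≤ y generalizing x y
    · exact (this y x h2 h1 h4 h3 h5.symm (by omega)).symm
    have h6 := (Nat.modEq_iff_dvd' hxy).1 h5
    by_contra hne
    have := Nat.le_of_dvd (by omega) h6
    omega
  refine cliqueWidth_le_of_ordering G (fun v => toLex (s v, row v))
    (fun u v huv => h.row_injective (by simpa using congrArg (fun x => (ofLex x).2) huv)) _ ?_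
  intro a
  -- A type records whether `u` is in an earlier cell, whether it is close enough to the cell of `a`
  -- to matter, its column within a window of width `2 * n`, and its steps on the two bounding
  -- staircases. When `s a = 0` no earlier cell exists, so the truncated `s a - 1` is harmless.
  refine ⟨fun u => (decide (s u < s a), decide ((s a - 1) * n ≤ col u),
    ⟨col u % (2 * n), Nat.mod_lt _ (by omega)⟩, ⟨p (s a - 1) (row u), hpb _ _⟩,
    ⟨p (s a) (row u), hpb _ _⟩), ?_⟩
  intro u v hu hv huv w hw
  simp only [Prod.mk.injEq, decide_eq_decide, Fin.mk.injEq] at huv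
  obtain ⟨e1, e2, e3, e4, e5⟩ := huv
  rw [Prod.Lex.toLex_lt_toLex] at hu hv
  rw [Prod.Lex.toLex_le_toLex] at hw
  dsimp only at hu hv hw
  by_cases hlt : s u < s a
  · have hlt' := e1.1 hlt
    obtain ⟨k, hk⟩ : ∃ k, s a = k + 1 := ⟨s a - 1, by omega⟩
    rw [hk, Nat.add_sub_cancel] at e2 e4
    have hu1 := hleft k u (by omega)
    have hv1 := hleft k v (by omega)
    have hw1 := hright k w (by omega)
    by_cases hc : k * n ≤ col u
    · have hc' := e2.1 hc
      have h1 := hmiss k u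
      have h2 := hmiss k v
      exact h.adj_iff_of_staircase (hp k) hu1 hv1 hw1
        (hmod _ _ (k * n + n) (by omega) (by omega) (by omega) (by omega) e3) e4
    -- Left of strip `k`, a vertex is at least two columns from everything beyond staircase `k`.
    · have hc' := e2.not.1 hc
      have h1 := hmiss k w
      rw [h.adj_iff, h.adj_iff]
      omega
  · have hlt' := e1.not.1 hlt
    have hu2 : s u = s a ∧ row u < row a := by omega
    have hv2 : s v = s a ∧ row v < row a := by omega
    have hcol : col u = col v := by
      have h1 := hwin u
      have h2 := hwin v
      rw [hu2.1] at h1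
      rw [hv2.1] at h2
      exact hmod _ _ (s a * n) h1.1 h2.1 h1.2 h2.2 e3
    rcases hw with hw | hw
    · exact h.adj_iff_of_staircase (hp (s a)) (hleft _ u hu2.1.le) (hleft _ v hv2.1.le)
        (hright _ w hw) hcol e5
    -- Within the cell, all remaining vertices lie in higher rows, so the column alone decides
    -- adjacency.
    · have h1 : row u < row w := by omega
      have h2 : row v < row w := by omega
      have hne : u ≠ w := fun e => by rw [e] at h1; omega
      have hne' : v ≠ w := fun e => by rw [e] at h2; omega
      have h3 : ¬ row w < row u := by omega
      have h4 : ¬ row w < row v := by omega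
      rw [h.adj_iff, h.adj_iff, hcol]
      simp [hne, hne', h1, h2, h3, h4]

theorem hasBoundedCliqueWidth_of_ssubset {X : Set FinGraph.{u}} (hX : IsHereditary X)
    (hss : X ⊂ unitIntervalGraphs.{u}) : HasBoundedCliqueWidth X := by
  obtain ⟨hsub, hns⟩ := hss
  obtain ⟨G, hG, hGX⟩ := Set.not_subset.1 hns
  have := G.finite
  obtain ⟨col, row, hgrid⟩ := IsUnitInterval.exists_isGridModel hG
  obtain ⟨n, m, hn, ⟨φ⟩⟩ := hgrid.exists_embedding_gridGraph
  refine ⟨Fintype.card (Bool × Bool × Fin (2 * n) × Fin (n * m) × Fin (n * m)) + 1,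
    fun H hH => ?_⟩
  have := H.finite
  have := H.nonempty
  obtain ⟨col', row', hgrid'⟩ := IsUnitInterval.exists_isGridModel (hsub hH)
  exact hgrid'.cliqueWidth_le hn ⟨fun ψ => hGX (hX H hH G ⟨ψ.comp φ⟩)⟩

theorem mainTheorem1 :
    (∀ X : Set FinGraph.{u}, IsHereditary X → X ⊂ unitIntervalGraphs.{u} →
      HasBoundedCliqueWidth X) ∧
    Minimal (fun X : Set FinGraph.{u} => IsHereditary X ∧ ¬ HasBoundedCliqueWidth X)
      unitIntervalGraphs.{u} := by
  refine ⟨fun X hX hss => hasBoundedCliqueWidth_of_ssubset hX hss,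
    ⟨isHereditary_unitIntervalGraphs, not_hasBoundedCliqueWidth_unitIntervalGraphs⟩, ?_⟩
  rintro Y ⟨hY, hYb⟩ hle
  by_contra hns
  exact hYb (hasBoundedCliqueWidth_of_ssubset hY ⟨hle, hns⟩)
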